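/- Let $n\in\mathbb{N}$, let $x_0,\xi_0\in\mathbb{R}^n$ with $|\xi_0|=1$, let $b\in C_c^\infty(\mathbb{R}^n)$ be complex-valued, and let $A\in\mathbb{C}^{n\times n}$ have positive definite imaginary part, i.e. $\operatorname{Im}\langle Av,v\rangle>0$ for all $0\ne v\in\mathbb{R}^n$, where $\langle Av,v\rangle=\sum_{p,q}A_{pq}v_qv_p$. For real $k\ge1$ let $h_k$ be the coherent state $$h_k(x)=k^{n/4}\,e^{ik\langle x-x_0,\xi_0\rangle}\,e^{\frac{ik}{2}\langle A(x-x_0),\,x-x_0\rangle}\,b(x),\qquad x\in\mathbb{R}^n.$$ For $\mu\in\mathbb{R}$ let $S^\mu(\mathbb{R}^{2n})$ be the set of $a\in C^\infty(\mathbb{R}^n\times\mathbb{R}^n;\mathbb{C})$ such that for all multi-indices $\alpha,\beta$ there is a constant $C_{\alpha,\beta}$ with $|\partial_x^\alpha\partial_\xi^\beta a(x,\xi)|\le C_{\alpha,\beta}(1+|\xi|)^{\mu-|\beta|}$ for all $x,\xi\in\mathbb{R}^n$, and for $u\in C_c^\infty(\mathbb{R}^n)$ let $$\operatorname{Op}(a)u(x)=(2\pi)^{-n}\int_{\mathbb{R}^n}\int_{\mathbb{R}^n}e^{i\langle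 x-y,\xi\rangle}a(x,\xi)u(y)\,dy\,d\xi.$$ Let $m\in\mathbb{R}$ and let $a\in S^m_{c\ell}(\mathbb{R}^{2n})$ be a polyhomogeneous symbol with compact support in $x$ (there is a compact $K\subset\mathbb{R}^n$ with $a(x,\xi)=0$ for all $x\notin K$ and all $\xi$) and with polyhomogeneous expansion $a\sim\sum_{j\ge0}a_{m-j}$. This means: for every $j\ge0$, $a_{m-j}\in S^{m-j}(\mathbb{R}^{2n})$ and there is $c_j\in(0,1)$ such that $a_{m-j}(x,s\xi)=s^{m-j}a_{m-j}(x,\xi)$ for all $x,\xi$ and all $s>0$ with $|\xi|\ge c_j$ and $|s\xi|\ge c_j$; and $a-\sum_{j=0}^{N-1}a_{m-j}\in S^{m-N}(\mathbb{R}^{2n})$ for every integer $N\ge0$. Suppose that there is an $\ell\in\mathbb{N}=\{0,1,2,\dots\}$ such that for every $j\le\ell/2$ the function $a_{m-j}$ vanishes to order $\ell-2j$ at $(x_0,\xi_0)$, i.e. all its partial derivatives (in $x$ and $\xi$) of total order less than $\ell-2j$ vanish at $(x_0,\xi_0)$. Then $\operatorname{Op}(a)h_k\in L^2(\mathbb{R}^n)$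 for every $k\ge1$, and for every $\varepsilon>0$ there is a constant $C_\varepsilon>0$, independent of $k$, such that $$\|\operatorname{Op}(a)h_k\|_{L^2(\mathbb{R}^n)}\le C_\varepsilon\,k^{m-\frac{\ell}{2}+\varepsilon}\qquad\text{for all }k\ge1.$$ -/

import Mathlib

open MeasureTheory Complex
open scoped ContDiff

/-- The Euclidean space `ℝⁿ`. -/
abbrev RSpace (n : ℕ) : Type := EuclideanSpace ℝ (Fin n)

/-- The Kohn-Nirenberg symbol class `S^m(ℝ²ⁿ)`: smooth functions `a(x, ξ)` with
`|∂_x^α ∂_ξ^β a(x, ξ)| ≤ C_{α,β} (1 + |ξ|)^{m - |β|}` for all multi-indices `α`, `β`. The partial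
derivatives with `|α| = p` and `|β| = q` are grouped into the Fréchet derivative of order `p` in `x`
of the Fréchet derivative of order `q` in `ξ`. -/
structure IsSymbol {n : ℕ} (m : ℝ) (a : RSpace n × RSpace n → ℂ) : Prop where
  smooth : ContDiff ℝ ∞ a
  bound : ∀ p q : ℕ, ∃ C : ℝ, ∀ x ξ : RSpace n,
    ‖iteratedFDeriv ℝ p (fun x' => iteratedFDeriv ℝ q (fun ξ' => a (x', ξ')) ξ) x‖
      ≤ C * (1 + ‖ξ‖) ^ (m - (q : ℝ))

/-- `a` is positively homogeneous of degree `d` in `ξ` on the region `|ξ| ≥ c`. -/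
def IsHomogeneousAbove {n : ℕ} (c d : ℝ) (a : RSpace n × RSpace n → ℂ) : Prop :=
  ∀ (x ξ : RSpace n) (s : ℝ), 0 < s → c ≤ ‖ξ‖ → c ≤ ‖s • ξ‖ →
    a (x, s • ξ) = ((s ^ d : ℝ) : ℂ) * a (x, ξ)

/-- `a ∼ ∑_{j ≥ 0} a_{m-j}` is a polyhomogeneous expansion of order `m`, where `aj j` stands for
`a_{m-j}`. The class `S^m_cl(ℝ²ⁿ)` consists of the functions `a` having such an expansion
(`remainder` with `N = 0` says that `a` is in `S^m`, and each `a_{m-j}` is in `S^{m-j}_cl`, being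
its own expansion). The threshold of homogeneity may depend on `j`; it lies below `1`, so that
`a_{m-j}` is homogeneous near the unit cosphere. -/
structure HasPolyhomogeneousExpansion {n : ℕ} (m : ℝ) (a : RSpace n × RSpace n → ℂ)
    (aj : ℕ → RSpace n × RSpace n → ℂ) : Prop where
  term_symbol : ∀ j : ℕ, IsSymbol (m - (j : ℝ)) (aj j)
  term_homogeneous : ∀ j : ℕ, ∃ c : ℝ, 0 < c ∧ c < 1 ∧ IsHomogeneousAbove c (m - (j : ℝ)) (aj j)
  remainder : ∀ N : ℕ,
    IsSymbol (m - (N : ℝ)) (fun z => a z - ∑ j ∈ Finset.range N, aj j z)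

/-- `f` vanishes to order `r` at `z`: all its derivatives of order less than `r` vanish there. -/
def VanishesToOrder {n : ℕ} (r : ℕ) (f : RSpace n × RSpace n → ℂ) (z : RSpace n × RSpace n) :
    Prop :=
  ∀ i : ℕ, i < r → iteratedFDeriv ℝ i f z = 0

/-- The bilinear quadratic form `⟨A v, v⟩ = ∑ A_{pq} v_q v_p` of a complex matrix at a real
vector. -/
noncomputable def matrixForm {n : ℕ} (A : Matrix (Fin n) (Fin n) ℂ) (v : RSpace n) : ℂ :=
  ∑ p, ∑ q, A p q * (v q : ℂ) * (v p : ℂ)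

/-- The imaginary part `(Im A_{pq})` is positive definite as a quadratic form on `ℝⁿ`; `A` need not
be symmetric. -/
def HasPosDefIm {n : ℕ} (A : Matrix (Fin n) (Fin n) ℂ) : Prop :=
  ∀ v : RSpace n, v ≠ 0 → 0 < ∑ p, ∑ q, (A p q).im * v q * v p

/-- The coherent state
`h_k(x) = k^{n/4} e^{i k ⟨x - x₀, ξ₀⟩} e^{(i k / 2) ⟨A (x - x₀), x - x₀⟩} b(x)`. -/
noncomputable def coherentState {n : ℕ} (x₀ ξ₀ : RSpace n) (A : Matrix (Fin n) (Fin n) ℂ)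
    (b : RSpace n → ℂ) (k : ℝ) (x : RSpace n) : ℂ :=
  ((k ^ ((n : ℝ) / 4) : ℝ) : ℂ) * exp (I * (k : ℂ) * ((inner ℝ (x - x₀) ξ₀ : ℝ) : ℂ))
    * exp (I * (k : ℂ) / 2 * matrixForm A (x - x₀)) * b x

/-- The standard (left) quantization
`Op(a) u (x) = (2π)^{-n} ∫ (∫ e^{i ⟨x - y, ξ⟩} a(x, ξ) u(y) dy) dξ`. -/
noncomputable def Op {n : ℕ} (a : RSpace n × RSpace n → ℂ) (u : RSpace n → ℂ) (x : RSpace n) : ℂ :=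
  (((2 * Real.pi) ^ n : ℝ) : ℂ)⁻¹ *
    ∫ ξ : RSpace n, ∫ y : RSpace n,
      exp (I * ((inner ℝ (x - y) ξ : ℝ) : ℂ)) * a (x, ξ) * u y

/-! A coherent state lives at distance `k ^ (-1/2)` from `(x₀, ξ₀)` in position and, after dividing
the frequency by `k`, also in frequency. Put `y = x₀ + w / √k` and `ξ = k ξ₀ + 2π √k η`. Up to a
unimodular factor, `Op a h_k (x)` becomes `k ^ (n/4)` times the inverse Fourier transform of `a (x,
k ξ₀ + 2π √k η) * 𝓕 (rescaledState) η`, evaluated at `z = √k (x - x₀)` (`Op_coherentState`). The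
rescaled states are bounded in the Schwartz space uniformly in `k ≥ 1`.

Two bounds on this inverse transform are available. By homogeneity and Taylor's formula, `a_{m-j}`
is of size `k ^ (m-j)` times `k ^ (-(ℓ-2j)/2)`, that is `k ^ (m-ℓ/2)`, up to polynomial factors in
`z` and `η`; the `L¹` bound on the inverse transform then gives `k ^ (m-ℓ/2) (1+|z|) ^ ℓ`. On the
other hand, `k ^ (-m) a` is a uniformly temperate family in `η`, so the inverse transform is `k ^ m`
times a rapidly decaying function of `z`, uniformly in the frozen parameter `x`.

The first bound is used for `1+|z| ≤ k ^ δ`, the second beyond (`exists_pow_mul_le_rpow`); this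
costs the factor `k ^ ε`. The resulting pointwise bound decays like `(1+|z|) ^ (-(n+1))`, and
integrating its square over `x` gives `k ^ (-n/2)`, which cancels the normalization. -/

open scoped FourierTransform
open Module (finrank)

/-! ### Bounded families of Schwartz functions and their Fourier transforms -/

section Families

variable {ι E : Type*} [NormedAddCommGroup E] [InnerProductSpace ℝ E]

/-- A family of functions that is bounded in the Schwartz space. -/
structure UniformlySchwartz (F : ι → E → ℂ) : Prop where
  smooth : ∀ i, ContDiff ℝ ∞ (F i)
  decay : ∀ N q : ℕ, ∃ C : ℝ, ∀ i v, (1 + ‖v‖) ^ N * ‖iteratedFDeriv ℝ q (F i) v‖ ≤ C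

/-- A family of smooth functions whose derivatives grow polynomially, uniformly in the family. -/
structure UniformlyTemperate (F : ι → E → ℂ) : Prop where
  smooth : ∀ i, ContDiff ℝ ∞ (F i)
  growth : ∀ q : ℕ, ∃ (M : ℕ) (C : ℝ), ∀ i v, ‖iteratedFDeriv ℝ q (F i) v‖ ≤ C * (1 + ‖v‖) ^ M

/-- In the Leibniz formula, growth of order `M p` of the first factor is absorbed by asking for `N +
M p` powers of decay from the second. -/
lemma UniformlyTemperate.mul {F G : ι → E → ℂ} (hF : UniformlyTemperate F)
    (hG : UniformlySchwartz G) : UniformlySchwartz (fun i v => F i v * G i v) := by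
  refine ⟨fun i => (hF.smooth i).mul (hG.smooth i), fun N q => ?_⟩
  choose M C hC using hF.growth
  choose D hD using hG.decay
  refine ⟨∑ p ∈ Finset.range (q + 1), (q.choose p : ℝ) * C p * D (N + M p) (q - p),
    fun i v => ?_⟩
  have h := norm_iteratedFDeriv_mul_le (hF.smooth i) (hG.smooth i) v (n := q)
    (by exact_mod_cast le_top)
  calc _ ≤ (1 + ‖v‖) ^ N * ∑ p ∈ Finset.range (q + 1),
        (q.choose p : ℝ) * ‖iteratedFDeriv ℝ p (F i) v‖ * ‖iteratedFDeriv ℝ (q - p) (G i) v‖ := by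
        gcongr
    _ ≤ _ := by
        rw [Finset.mul_sum]
        refine Finset.sum_le_sum fun p _ => ?_
        have h1 := hC p i v
        have h2 := hD (N + M p) (q - p) i v
        have hC0 : 0 ≤ C p :=
          nonneg_of_mul_nonneg_left ((norm_nonneg _).trans h1) (by positivity)
        calc _ ≤ (1 + ‖v‖) ^ N * ((q.choose p : ℝ) * (C p * (1 + ‖v‖) ^ M p) *
              ‖iteratedFDeriv ℝ (q - p) (G i) v‖) := by gcongr
          _ = (q.choose p : ℝ) * C p *
              ((1 + ‖v‖) ^ (N + M p) * ‖iteratedFDeriv ℝ (q - p) (G i) v‖) := by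
              rw [pow_add]; ring
          _ ≤ _ := by gcongr

lemma UniformlySchwartz.reindex {κ : Type*} {F : ι → E → ℂ} (hF : UniformlySchwartz F)
    (φ : κ → ι) : UniformlySchwartz (fun j => F (φ j)) :=
  ⟨fun _ => hF.smooth _, fun N q => (hF.decay N q).imp fun _ h _ => h _⟩

variable [FiniteDimensional ℝ E] [MeasurableSpace E] [BorelSpace E]

lemma integrable_one_add_norm_pow_inv :
    Integrable (fun v : E => ((1 + ‖v‖) ^ (finrank ℝ E + 1))⁻¹) := by
  have h := integrable_one_add_norm (E := E) (μ := volume) (r := (finrank ℝ E + 1 : ℕ))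
    (by push_cast; linarith)
  refine h.congr (Filter.Eventually.of_forall fun v => ?_)
  simp only
  rw [Real.rpow_neg (by positivity), Real.rpow_natCast]

lemma integrable_and_integral_le_of_pow_mul_le {f : E → ℝ} (hf : Continuous f) {C : ℝ}
    (h : ∀ v, (1 + ‖v‖) ^ (finrank ℝ E + 1) * |f v| ≤ C) :
    Integrable f ∧ ∫ v, f v ≤ C * ∫ v : E, ((1 + ‖v‖) ^ (finrank ℝ E + 1))⁻¹ := by
  have hb : ∀ v, |f v| ≤ C * ((1 + ‖v‖) ^ (finrank ℝ E + 1))⁻¹ := fun v => by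
    rw [← div_eq_mul_inv, le_div_iff₀ (by positivity), mul_comm]
    exact h v
  have hi := (integrable_one_add_norm_pow_inv (E := E)).const_mul C
  have hfi : Integrable f :=
    hi.mono' hf.aestronglyMeasurable (Filter.Eventually.of_forall fun v => by
      simpa using hb v)
  refine ⟨hfi, ?_⟩
  rw [← integral_const_mul]
  exact integral_mono hfi hi fun v => (le_abs_self _).trans (hb v)

lemma UniformlySchwartz.integrable {F : ι → E → ℂ} (hF : UniformlySchwartz F) (p q : ℕ) :
    ∃ C : ℝ, ∀ i, Integrable (fun v => ‖v‖ ^ p * ‖iteratedFDeriv ℝ q (F i) v‖) ∧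
      ∫ v, ‖v‖ ^ p * ‖iteratedFDeriv ℝ q (F i) v‖ ≤ C := by
  obtain ⟨C, hC⟩ := hF.decay (finrank ℝ E + 1 + p) q
  refine ⟨C * ∫ v : E, ((1 + ‖v‖) ^ (finrank ℝ E + 1))⁻¹, fun i =>
    integrable_and_integral_le_of_pow_mul_le ?_ fun v => ?_⟩
  · exact (continuous_norm.pow p).mul
      ((hF.smooth i).continuous_iteratedFDeriv (by exact_mod_cast le_top)).norm
  · refine le_trans ?_ (hC i v)
    rw [abs_of_nonneg (by positivity), pow_add _ (finrank ℝ E + 1) p, mul_assoc]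
    have : ‖v‖ ^ p ≤ (1 + ‖v‖) ^ p := pow_le_pow_left₀ (norm_nonneg v) (by linarith) p
    gcongr

/-- The Fourier transform exchanges weights and derivatives, so each seminorm of `𝓕 (F i)` is
controlled by finitely many weighted `L¹` norms of derivatives of `F i`, which are uniform in `i`.
-/
lemma UniformlySchwartz.fourier {F : ι → E → ℂ} (hF : UniformlySchwartz F) :
    UniformlySchwartz (fun i => 𝓕 (F i)) := by
  refine ⟨fun i => Real.contDiff_fourier (N := ⊤) fun n _ => ?_, fun N q => ?_⟩
  · simpa using ((hF.integrable n 0).choose_spec i).1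
  · choose C hC using fun p q => hF.integrable p q
    have key : ∀ N : ℕ, ∃ D : ℝ, ∀ i v, ‖v‖ ^ N * ‖iteratedFDeriv ℝ q (𝓕 (F i)) v‖ ≤ D := by
      intro N
      refine ⟨(2 * Real.pi) ^ q * (2 * q + 2) ^ N *
        ∑ p ∈ Finset.range (q + 1) ×ˢ Finset.range (N + 1), C p.1 p.2, fun i v => ?_⟩
      refine (Real.pow_mul_norm_iteratedFDeriv_fourier_le (K := ⊤) (N := ⊤) (hF.smooth i)
        (fun k n _ _ => (hC k n i).1) le_top le_top v).trans ?_
      gcongr with p hp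
      exact (hC _ _ i).2
    obtain ⟨D₀, hD₀⟩ := key 0
    obtain ⟨D, hD⟩ := key N
    refine ⟨2 ^ (N - 1) * (D₀ + D), fun i v => ?_⟩
    calc _ ≤ (2 ^ (N - 1) * (1 ^ N + ‖v‖ ^ N)) * ‖iteratedFDeriv ℝ q (𝓕 (F i)) v‖ := by
          gcongr
          exact add_pow_le zero_le_one (norm_nonneg v) N
      _ = 2 ^ (N - 1) * (‖v‖ ^ 0 * ‖iteratedFDeriv ℝ q (𝓕 (F i)) v‖ +
            ‖v‖ ^ N * ‖iteratedFDeriv ℝ q (𝓕 (F i)) v‖) := by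
          rw [one_pow]; ring
      _ ≤ _ := by
          gcongr
          exacts [hD₀ i v, hD i v]

/-- Rapid decay of the inverse Fourier transforms of a bounded family of Schwartz functions. -/
lemma UniformlySchwartz.norm_fourierInv_le {F : ι → E → ℂ} (hF : UniformlySchwartz F) (N : ℕ) :
    ∃ C : ℝ, ∀ i v, (1 + ‖v‖) ^ N * ‖𝓕⁻ (F i) v‖ ≤ C := by
  obtain ⟨C, hC⟩ := hF.fourier.decay N 0
  refine ⟨C, fun i v => ?_⟩
  simpa [Real.fourierInv_eq_fourier_neg] using hC i (-v)

/-- Pointwise polynomial bounds on the factor `f` bound the inverse Fourier transform of `f * G`. -/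
lemma UniformlySchwartz.norm_fourierInv_mul_le {G : ι → E → ℂ} (hG : UniformlySchwartz G)
    (M : ℕ) : ∃ C : ℝ, 0 ≤ C ∧ ∀ i (f : E → ℂ) (B : ℝ), Continuous f → 0 ≤ B →
      (∀ v, ‖f v‖ ≤ B * (1 + ‖v‖) ^ M) → ∀ w, ‖𝓕⁻ (fun v => f v * G i v) w‖ ≤ C * B := by
  obtain ⟨C, hC⟩ := hG.decay (finrank ℝ E + 1 + M) 0
  refine ⟨|C| * ∫ v : E, ((1 + ‖v‖) ^ (finrank ℝ E + 1))⁻¹, by positivity,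
    fun i f B hf hB h w => ?_⟩
  have h1 : ‖𝓕⁻ (fun v => f v * G i v) w‖ ≤ ∫ v, ‖f v * G i v‖ := by
    rw [Real.fourierInv_eq]
    refine (norm_integral_le_integral_norm _).trans (le_of_eq ?_)
    simp only [Circle.norm_smul]
  have h2 := (integrable_and_integral_le_of_pow_mul_le (f := fun v => ‖f v * G i v‖)
    (hf.mul (hG.smooth i).continuous).norm (C := B * |C|) fun v => ?_).2
  · exact (h1.trans h2).trans_eq (by ring)
  · have h3 := (hC i v).trans (le_abs_self C)
    rw [norm_iteratedFDeriv_zero] at h3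
    rw [abs_of_nonneg (norm_nonneg _), norm_mul]
    calc _ ≤ (1 + ‖v‖) ^ (finrank ℝ E + 1) * (B * (1 + ‖v‖) ^ M * ‖G i v‖) := by
          gcongr
          exact h v
      _ = B * ((1 + ‖v‖) ^ (finrank ℝ E + 1 + M) * ‖G i v‖) := by rw [pow_add]; ring
      _ ≤ _ := by gcongr

end Families

/-! ### Taylor bound at a zero of finite order -/

section Taylor

universe u

/-- A smooth function all of whose derivatives of order less than `r` vanish at `z` is
`O(‖y - z‖ ^ r)` near `z`. -/
lemma exists_norm_le_pow_of_iteratedFDeriv_eq_zero {E : Type u} [NormedAddCommGroup E]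
    [NormedSpace ℝ E] {z : E} (r : ℕ) : ∀ {F : Type u} [NormedAddCommGroup F] [NormedSpace ℝ F]
    {f : E → F}, ContDiff ℝ ∞ f → (∀ i < r, iteratedFDeriv ℝ i f z = 0) →
    ∃ C δ : ℝ, 0 ≤ C ∧ 0 < δ ∧ ∀ y, ‖y - z‖ ≤ δ → ‖f y‖ ≤ C * ‖y - z‖ ^ r := by
  induction r with
  | zero =>
    intro F _ _ f hf _
    have h : ∀ᶠ y in nhds z, ‖f y‖ < ‖f z‖ + 1 :=
      hf.continuous.norm.continuousAt.eventually_lt continuousAt_const (lt_add_one _)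
    obtain ⟨δ, hδ, hb⟩ := Metric.nhds_basis_closedBall.eventually_iff.1 h
    refine ⟨‖f z‖ + 1, δ, by positivity, hδ, fun y hy => ?_⟩
    simpa using (hb (by simpa [dist_eq_norm] using hy)).le
  | succ r ih =>
    intro F _ _ f hf h0
    -- The induction passes to `fderiv ℝ f` and integrates back by the mean value inequality on the
    -- ball of radius `‖y - z‖`. The target changes to a space of linear maps, hence the
    -- quantification over `F` in the universe of `E`.
    obtain ⟨C, δ, hC, hδ, hb⟩ := ih (f := fderiv ℝ f) (hf.fderiv_right le_rfl) fun i hi => by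
      rw [← norm_eq_zero, norm_iteratedFDeriv_fderiv, h0 _ (by omega), norm_zero]
    refine ⟨C, δ, hC, hδ, fun y hy => ?_⟩
    have hfz : f z = 0 := by
      rw [← norm_eq_zero, ← norm_iteratedFDeriv_zero (𝕜 := ℝ), h0 0 (by omega), norm_zero]
    have h := (convex_closedBall z ‖y - z‖).norm_image_sub_le_of_norm_fderiv_le (𝕜 := ℝ) (f := f)
      (C := C * ‖y - z‖ ^ r) (x := z) (y := y)
      (fun w _ => (hf.differentiable (by simp)).differentiableAt) (fun w hw => ?_)
      (by simp) (by simp [dist_eq_norm])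
    · rw [hfz, sub_zero] at h
      rwa [pow_succ, ← mul_assoc]
    · have hw' : ‖w - z‖ ≤ ‖y - z‖ := by simpa [dist_eq_norm] using hw
      exact (hb w (hw'.trans hy)).trans (by gcongr)

end Taylor

/-! ### The Gaussian factor and the rescaled coherent states -/

section Gaussian

/-- The identity `exp (w + z) = exp w * exp z` moves the derivative from `w` to `0`, leaving a
constant that depends on `q` only. -/
lemma norm_iteratedFDeriv_exp (q : ℕ) (w : ℂ) :
    ‖iteratedFDeriv ℝ q Complex.exp w‖ = ‖Complex.exp w‖ * ‖iteratedFDeriv ℝ q Complex.exp 0‖ := by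
  have h := iteratedFDeriv_comp_add_left (𝕜 := ℝ) (f := Complex.exp) q w 0
  have h2 : (fun z => Complex.exp (w + z)) = Complex.exp w • Complex.exp := by
    ext z; simp [Complex.exp_add]
  rw [add_zero, h2, iteratedFDeriv_const_smul_apply Complex.contDiff_exp.contDiffAt] at h
  rw [← h, norm_smul]

lemma iteratedFDeriv_comp_affine {E F : Type*} [NormedAddCommGroup E] [NormedSpace ℝ E]
    [NormedAddCommGroup F] [NormedSpace ℝ F] {f : E → F} (hf : ContDiff ℝ ∞ f) (q : ℕ) (c : E)
    (s : ℝ) (w : E) :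
    iteratedFDeriv ℝ q (fun v => f (c + s • v)) w = s ^ q • iteratedFDeriv ℝ q f (c + s • w) := by
  have h : ContDiff ℝ q (fun v => f (c + v)) :=
    (hf.comp (contDiff_const.add contDiff_id)).of_le (by exact_mod_cast le_top)
  rw [iteratedFDeriv_comp_const_smul (f := fun v => f (c + v)) s h]
  simp only [iteratedFDeriv_comp_add_left]

variable {n : ℕ}

lemma matrixForm_im (A : Matrix (Fin n) (Fin n) ℂ) (v : RSpace n) :
    (matrixForm A v).im = ∑ p, ∑ q, (A p q).im * v q * v p := by
  simp [matrixForm, Complex.im_sum]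

lemma hasTemperateGrowth_matrixForm (A : Matrix (Fin n) (Fin n) ℂ) :
    (fun v => I / 2 * matrixForm A v).HasTemperateGrowth := by
  have h : ∀ p, (fun v : RSpace n => (v p : ℂ)).HasTemperateGrowth := fun p =>
    (Complex.ofRealCLM.comp (EuclideanSpace.proj p)).hasTemperateGrowth
  unfold matrixForm
  fun_prop

lemma HasPosDefIm.exists_coercive {A : Matrix (Fin n) (Fin n) ℂ} (hA : HasPosDefIm A) :
    ∃ c : ℝ, 0 < c ∧ ∀ v : RSpace n, c * ‖v‖ ^ 2 ≤ (matrixForm A v).im := by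
  -- The sphere is empty exactly when `n = 0`; otherwise `c` is the minimum over the compact sphere,
  -- extended by homogeneity of degree 2.
  rcases (Metric.sphere (0 : RSpace n) 1).eq_empty_or_nonempty with he | hne
  · refine ⟨1, one_pos, fun v => ?_⟩
    rcases eq_or_ne v 0 with rfl | hv
    · simp [matrixForm]
    · exact absurd (show (‖v‖⁻¹ • v) ∈ Metric.sphere (0 : RSpace n) 1 by
        simp [norm_smul, hv]) (by simp [he])
  · have hcont : Continuous fun v : RSpace n => (matrixForm A v).im := by
      unfold matrixForm; fun_prop
    obtain ⟨u, hu, hmin⟩ := (isCompact_sphere (0 : RSpace n) 1).exists_isMinOn hne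
      hcont.continuousOn
    have hu1 : ‖u‖ = 1 := by simpa using hu
    refine ⟨(matrixForm A u).im, ?_, fun v => ?_⟩
    · rw [matrixForm_im]
      exact hA u (by rintro rfl; simp at hu1)
    · rcases eq_or_ne v 0 with rfl | hv
      · simp [matrixForm]
      have h := hmin (show (‖v‖⁻¹ • v) ∈ Metric.sphere (0 : RSpace n) 1 by simp [norm_smul, hv])
      have h2 : (matrixForm A (‖v‖⁻¹ • v)).im = (‖v‖⁻¹) ^ 2 * (matrixForm A v).im := by
        simp only [matrixForm_im, Finset.mul_sum, PiLp.smul_apply, smul_eq_mul]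
        exact Finset.sum_congr rfl fun _ _ => Finset.sum_congr rfl fun _ _ => by ring
      have h3 : (matrixForm A u).im ≤ (‖v‖⁻¹) ^ 2 * (matrixForm A v).im := h2 ▸ h
      rwa [inv_pow, ← div_eq_inv_mul, le_div_iff₀ (by positivity)] at h3

lemma one_add_norm_pow_mul_exp_le {c t : ℝ} (hc : 0 < c) (ht : 0 ≤ t) (N : ℕ) :
    (1 + t) ^ N * Real.exp (-(c * t ^ 2)) ≤ Real.exp (N ^ 2 / (4 * c)) := by
  calc _ ≤ Real.exp t ^ N * Real.exp (-(c * t ^ 2)) := by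
        gcongr
        linarith [Real.add_one_le_exp t]
    _ = Real.exp (N * t - c * t ^ 2) := by
        rw [← Real.exp_nat_mul, ← Real.exp_add]; ring_nf
    _ ≤ _ := by
        rw [Real.exp_le_exp, le_div_iff₀ (by positivity)]
        nlinarith [sq_nonneg (N - 2 * c * t)]

/-- Coercivity of `Im A` gives Gaussian decay, and derivatives cost only polynomial factors by the
Faà di Bruno bound `norm_iteratedFDeriv_comp_le`. -/
lemma uniformlySchwartz_gaussian {ι : Type*} {A : Matrix (Fin n) (Fin n) ℂ} (hA : HasPosDefIm A) :
    UniformlySchwartz (fun (_ : ι) (v : RSpace n) => exp (I / 2 * matrixForm A v)) := by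
  have ht := hasTemperateGrowth_matrixForm A
  refine ⟨fun _ => Complex.contDiff_exp.comp ht.1, fun N q => ?_⟩
  obtain ⟨c, hc, hco⟩ := hA.exists_coercive
  obtain ⟨k, C, hC, hb⟩ := ht.norm_iteratedFDeriv_le_uniform q
  set S := ∑ i ∈ Finset.range (q + 1), ‖iteratedFDeriv ℝ i Complex.exp 0‖ with hS
  refine ⟨(q.factorial * S * (1 + C) ^ q) * Real.exp ((N + k * q : ℕ) ^ 2 / (4 * (c / 2))),
    fun _ v => ?_⟩
  have hE : ‖exp (I / 2 * matrixForm A v)‖ ≤ Real.exp (-(c / 2 * ‖v‖ ^ 2)) := by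
    rw [Complex.norm_exp, Real.exp_le_exp]
    have : (I / 2 * matrixForm A v).re = -((matrixForm A v).im / 2) := by
      rw [div_mul_eq_mul_div, Complex.div_ofNat_re]; simp [neg_div]
    rw [this]
    linarith [hco v]
  have hD : ‖iteratedFDeriv ℝ q (fun v => exp (I / 2 * matrixForm A v)) v‖ ≤
      q.factorial * (Real.exp (-(c / 2 * ‖v‖ ^ 2)) * S) * ((1 + C) * (1 + ‖v‖) ^ k) ^ q := by
    refine norm_iteratedFDeriv_comp_le (g := Complex.exp) (N := ∞) Complex.contDiff_exp ht.1
      (by exact_mod_cast le_top) v (fun i hi => ?_) (fun i hi hiq => ?_)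
    · rw [norm_iteratedFDeriv_exp]
      gcongr
      exact Finset.single_le_sum (f := fun i => ‖iteratedFDeriv ℝ i Complex.exp 0‖)
        (fun _ _ => norm_nonneg _) (Finset.mem_range.2 (by omega))
    -- The composition bound wants the `i`-th derivative below `D ^ i`; with `1 + C` in place of `C`
    -- the base is at least 1, so one `D` serves all `i ≥ 1`.
    · have h1 : 1 ≤ (1 + ‖v‖) ^ k := one_le_pow₀ (by linarith [norm_nonneg v])
      calc _ ≤ C * (1 + ‖v‖) ^ k := hb i hiq v
        _ ≤ (1 + C) * (1 + ‖v‖) ^ k := by gcongr; linarith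
        _ ≤ _ := le_self_pow₀ (one_le_mul_of_one_le_of_one_le (by linarith) h1) (by omega)
  calc _ ≤ (1 + ‖v‖) ^ N * (q.factorial * (Real.exp (-(c / 2 * ‖v‖ ^ 2)) * S) *
          ((1 + C) * (1 + ‖v‖) ^ k) ^ q) := by gcongr
    _ = (q.factorial * S * (1 + C) ^ q) *
          ((1 + ‖v‖) ^ (N + k * q) * Real.exp (-(c / 2 * ‖v‖ ^ 2))) := by
        rw [pow_add, mul_pow, ← pow_mul]; ring
    _ ≤ _ := by
        have hS0 : 0 ≤ S := Finset.sum_nonneg fun _ _ => norm_nonneg _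
        gcongr
        exact one_add_norm_pow_mul_exp_le (by positivity) (norm_nonneg v) _

/-- The coherent state in the rescaled variable `v = √k (x - x₀)`, without its oscillating factor
and its normalization. -/
noncomputable def rescaledState (x₀ : RSpace n) (A : Matrix (Fin n) (Fin n) ℂ) (b : RSpace n → ℂ)
    (k : ℝ) (v : RSpace n) : ℂ :=
  b (x₀ + (√k)⁻¹ • v) * exp (I / 2 * matrixForm A v)

/-- Only the cutoff depends on `k`, and `q` derivatives of `b (x₀ + v / √k)` bring out `k ^ (-q/2) ≤
1`. -/
lemma uniformlySchwartz_rescaledState (x₀ : RSpace n) {A : Matrix (Fin n) (Fin n) ℂ}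
    (hA : HasPosDefIm A) {b : RSpace n → ℂ} (hb : ContDiff ℝ ∞ b) (hb_supp : HasCompactSupport b) :
    UniformlySchwartz (fun k : Set.Ici (1 : ℝ) => rescaledState x₀ A b k) := by
  refine UniformlyTemperate.mul (F := fun (k : Set.Ici (1 : ℝ)) v => b (x₀ + (√k)⁻¹ • v))
    ⟨fun k => hb.comp (by fun_prop), fun q => ?_⟩ (uniformlySchwartz_gaussian hA)
  obtain ⟨C, hC⟩ := (hb_supp.iteratedFDeriv (𝕜 := ℝ) q).exists_bound_of_continuous
    (hb.continuous_iteratedFDeriv (by exact_mod_cast le_top))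
  refine ⟨0, C, fun k v => ?_⟩
  rw [iteratedFDeriv_comp_affine hb, norm_smul, pow_zero, mul_one]
  refine (mul_le_of_le_one_left (norm_nonneg _) ?_).trans (hC _)
  rw [Real.norm_of_nonneg (by positivity)]
  exact pow_le_one₀ (by positivity) (inv_le_one_of_one_le₀ (Real.one_le_sqrt.2 k.2))

end Gaussian

/-! ### Symbols at the rescaled frequencies -/

section Symbols

variable {n : ℕ}

/-- The frequency `k ξ₀ + 2π √k η`. -/
noncomputable def rescaledFrequency (ξ₀ : RSpace n) (k : ℝ) (η : RSpace n) : RSpace n :=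
  k • ξ₀ + (2 * Real.pi * √k) • η

/-- Peetre's inequality for the rescaled frequencies. -/
lemma one_add_norm_rescaledFrequency_rpow_le {ξ₀ : RSpace n} (hξ₀ : ‖ξ₀‖ = 1) (μ : ℝ) {k : ℝ}
    (hk : 1 ≤ k) (η : RSpace n) :
    (1 + ‖rescaledFrequency ξ₀ k η‖) ^ μ ≤
      k ^ μ * (50 ^ ⌈|μ|⌉₊ * (1 + ‖η‖) ^ (2 * ⌈|μ|⌉₊)) := by
  have hk0 : 0 < k := by linarith
  set ξ := rescaledFrequency ξ₀ k η with hξ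
  have hs : √k ^ 2 = k := Real.sq_sqrt hk0.le
  have hs1 : 1 ≤ √k := Real.one_le_sqrt.2 hk
  have hpi := Real.pi_pos
  have hpi2 := Real.pi_lt_d2
  have hη := norm_nonneg η
  have hn1 : ‖k • ξ₀‖ = k := by rw [norm_smul, hξ₀, mul_one, Real.norm_of_nonneg hk0.le]
  have hn2 : ‖(2 * Real.pi * √k) • η‖ = 2 * Real.pi * √k * ‖η‖ := by
    rw [norm_smul, Real.norm_of_nonneg (by positivity)]
  have hup : ‖ξ‖ ≤ k + 2 * Real.pi * √k * ‖η‖ :=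
    (norm_add_le _ _).trans_eq (by rw [hn1, hn2])
  have hlow : k ≤ ‖ξ‖ + 2 * Real.pi * √k * ‖η‖ := by
    have := norm_sub_le ξ ((2 * Real.pi * √k) • η)
    rwa [hξ, rescaledFrequency, add_sub_cancel_right, hn1, hn2] at this
  -- `T` bounds both `(1 + ‖ξ‖) / k` and its inverse, which handles both signs of `μ`. The 50 comes
  -- from `2π < 7` and `7 √k ‖η‖ ≤ k/2 + 25 ‖η‖²`, after doubling.
  set T := 50 * (1 + ‖η‖) ^ 2 with hT
  have hT1 : 1 ≤ T := by nlinarith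
  have h1 : 1 + ‖ξ‖ ≤ k * T := by
    have : √k ≤ k := by nlinarith
    have : 2 * Real.pi * √k * ‖η‖ ≤ 7 * k * ‖η‖ := by gcongr; linarith
    nlinarith [mul_nonneg hk0.le hη]
  have h2 : k ≤ (1 + ‖ξ‖) * T := by
    have h3 : 2 * Real.pi * √k * ‖η‖ ≤ 7 * √k * ‖η‖ := by gcongr; linarith
    have h4 : 7 * √k * ‖η‖ ≤ k / 2 + 25 * ‖η‖ ^ 2 := by nlinarith [sq_nonneg (√k - 7 * ‖η‖)]
    have h5 : 0 ≤ ‖ξ‖ * ((1 + ‖η‖) ^ 2 - 1) := mul_nonneg (norm_nonneg ξ) (by nlinarith)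
    nlinarith [norm_nonneg ξ]
  have hξ0 : 0 < 1 + ‖ξ‖ := by positivity
  have key : ((1 + ‖ξ‖) / k) ^ μ ≤ T ^ |μ| := by
    rcases le_total 0 μ with hμ | hμ
    · rw [abs_of_nonneg hμ]
      exact Real.rpow_le_rpow (by positivity) (by rw [div_le_iff₀ hk0]; linarith) hμ
    · have e : ((1 + ‖ξ‖) / k) ^ μ = (k / (1 + ‖ξ‖)) ^ (-μ) := by
        rw [← inv_div, Real.inv_rpow (by positivity), Real.rpow_neg (by positivity)]
      rw [abs_of_nonpos hμ, e]
      exact Real.rpow_le_rpow (by positivity) (by rw [div_le_iff₀ hξ0]; linarith) (by linarith)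
  have h5 : T ^ |μ| ≤ T ^ ⌈|μ|⌉₊ := by
    rw [← Real.rpow_natCast]
    exact Real.rpow_le_rpow_of_exponent_le hT1 (Nat.le_ceil _)
  rw [Real.div_rpow hξ0.le hk0.le, div_le_iff₀ (by positivity)] at key
  calc _ ≤ T ^ |μ| * k ^ μ := key
    _ ≤ T ^ ⌈|μ|⌉₊ * k ^ μ := by gcongr
    _ = _ := by rw [hT, mul_pow, ← pow_mul, mul_comm]

lemma IsSymbol.norm_iteratedFDeriv_le {μ : ℝ} {f : RSpace n × RSpace n → ℂ} (hf : IsSymbol μ f)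
    (q : ℕ) : ∃ C : ℝ, 0 ≤ C ∧ ∀ x ξ : RSpace n,
      ‖iteratedFDeriv ℝ q (fun ξ' => f (x, ξ')) ξ‖ ≤ C * (1 + ‖ξ‖) ^ (μ - q) := by
  obtain ⟨C, hC⟩ := hf.bound 0 q
  refine ⟨|C|, abs_nonneg C, fun x ξ => ?_⟩
  have h := hC x ξ
  rw [norm_iteratedFDeriv_zero] at h
  exact h.trans (by gcongr; exact le_abs_self C)

/-- After rescaling, the symbols of order `μ` are `k ^ μ` times symbols that are bounded
uniformly in `x` and `k`. -/
lemma IsSymbol.uniformlyTemperate {ξ₀ : RSpace n} (hξ₀ : ‖ξ₀‖ = 1) {μ : ℝ}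
    {f : RSpace n × RSpace n → ℂ} (hf : IsSymbol μ f) :
    UniformlyTemperate (fun (i : RSpace n × Set.Ici (1 : ℝ)) η =>
      (((i.2 : ℝ) ^ (-μ) : ℝ) : ℂ) * f (i.1, rescaledFrequency ξ₀ i.2 η)) := by
  have hsm : ∀ x, ContDiff ℝ ∞ (fun ξ => f (x, ξ)) := fun x =>
    hf.smooth.comp (contDiff_const.prodMk contDiff_id)
  have hsm2 : ∀ x k, ContDiff ℝ ∞ (fun η => f (x, rescaledFrequency ξ₀ k η)) := fun x k =>
    (hsm x).comp (by unfold rescaledFrequency; fun_prop)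
  refine ⟨fun i => contDiff_const.mul (hsm2 _ _), fun q => ?_⟩
  obtain ⟨C, hC0, hC⟩ := hf.norm_iteratedFDeriv_le q
  set M := ⌈|μ - q|⌉₊ with hM
  refine ⟨2 * M, (2 * Real.pi) ^ q * C * 50 ^ M, fun ⟨x, k, hk⟩ η => ?_⟩
  have hk1 : 1 ≤ k := hk
  have hk0 : 0 < k := by linarith
  have h1 : iteratedFDeriv ℝ q (fun η => ((k ^ (-μ) : ℝ) : ℂ) * f (x, rescaledFrequency ξ₀ k η)) η
      = ((k ^ (-μ) : ℝ) : ℂ) • iteratedFDeriv ℝ q (fun η => f (x, rescaledFrequency ξ₀ k η)) η := by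
    simpa only [smul_eq_mul] using iteratedFDeriv_const_smul_apply' (𝕜 := ℝ)
      (a := ((k ^ (-μ) : ℝ) : ℂ)) ((hsm2 x k).of_le (by exact_mod_cast le_top)).contDiffAt
  have h2 := iteratedFDeriv_comp_affine (hsm x) q (k • ξ₀) (2 * Real.pi * √k) η
  have h3 := hC x (rescaledFrequency ξ₀ k η)
  have h4 := one_add_norm_rescaledFrequency_rpow_le hξ₀ (μ - q) hk1 η
  simp only
  rw [h1]
  unfold rescaledFrequency at h3 h4 ⊢
  rw [h2, norm_smul, norm_smul, Complex.norm_real, Real.norm_of_nonneg (by positivity),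
    Real.norm_of_nonneg (by positivity)]
  calc _ ≤ k ^ (-μ) * ((2 * Real.pi * √k) ^ q * (C * (k ^ (μ - q) *
          (50 ^ M * (1 + ‖η‖) ^ (2 * M))))) := by gcongr; exact h3.trans (by gcongr)
    _ = (k ^ (-μ) * √k ^ q * k ^ (μ - q)) *
          ((2 * Real.pi) ^ q * C * 50 ^ M * (1 + ‖η‖) ^ (2 * M)) := by
        rw [mul_pow]; ring
    _ ≤ _ := by
        -- Each `η`-derivative costs `√k` by the chain rule and gains `k⁻¹` from the symbol
        -- estimate.
        refine mul_le_of_le_one_left (by positivity) ?_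
        have h5 : √k ^ q ≤ k ^ (q : ℝ) := by
          rw [Real.rpow_natCast]
          exact pow_le_pow_left₀ (by positivity) (Real.sqrt_le_iff.2 ⟨hk0.le, by nlinarith⟩) q
        calc _ ≤ k ^ (-μ) * k ^ (q : ℝ) * k ^ (μ - q) := by gcongr
          _ = 1 := by
            rw [← Real.rpow_add hk0, ← Real.rpow_add hk0]; ring_nf; exact Real.rpow_zero k

lemma IsSymbol.norm_rescaled_le {ξ₀ : RSpace n} (hξ₀ : ‖ξ₀‖ = 1) {μ : ℝ}
    {f : RSpace n × RSpace n → ℂ} (hf : IsSymbol μ f) :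
    ∃ (M : ℕ) (C : ℝ), 0 ≤ C ∧ ∀ k : ℝ, 1 ≤ k → ∀ x η : RSpace n,
      ‖f (x, rescaledFrequency ξ₀ k η)‖ ≤ C * k ^ μ * (1 + ‖η‖) ^ M := by
  obtain ⟨M, C, hC⟩ := (hf.uniformlyTemperate hξ₀).growth 0
  refine ⟨M, |C|, abs_nonneg C, fun k hk x η => ?_⟩
  have hk0 : 0 < k := by linarith
  have h := hC (x, ⟨k, hk⟩) η
  rw [norm_iteratedFDeriv_zero, norm_mul, Complex.norm_real, Real.norm_of_nonneg (by positivity),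
    Real.rpow_neg hk0.le, inv_mul_le_iff₀ (by positivity)] at h
  calc _ ≤ k ^ μ * (C * (1 + ‖η‖) ^ M) := h
    _ = C * (k ^ μ * (1 + ‖η‖) ^ M) := by ring
    _ ≤ |C| * (k ^ μ * (1 + ‖η‖) ^ M) := by gcongr; exact le_abs_self C
    _ = _ := by ring

/-- A homogeneous symbol vanishing to order `r` at `(x₀, ξ₀)` gains `k ^ (-r / 2)` at distance
`k ^ (-1 / 2)` from the ray through `(x₀, ξ₀)`. -/
lemma IsSymbol.norm_rescaled_le_of_vanishesToOrder {x₀ ξ₀ : RSpace n} (hξ₀ : ‖ξ₀‖ = 1) {μ c : ℝ}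
    {f : RSpace n × RSpace n → ℂ} (hf : IsSymbol μ f) (hc : c < 1)
    (hhom : IsHomogeneousAbove c μ f) {r : ℕ} (hv : VanishesToOrder r f (x₀, ξ₀)) :
    ∃ (M : ℕ) (C : ℝ), 0 ≤ C ∧ ∀ k : ℝ, 1 ≤ k → ∀ x η : RSpace n,
      ‖f (x, rescaledFrequency ξ₀ k η)‖ ≤
        C * k ^ (μ - r / 2) * (1 + √k * ‖x - x₀‖) ^ r * (1 + ‖η‖) ^ M := by
  obtain ⟨C₁, δ₁, hC₁, hδ₁, hT⟩ := exists_norm_le_pow_of_iteratedFDeriv_eq_zero r hf.smooth hv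
  obtain ⟨M, C₀, hC₀, hS⟩ := hf.norm_rescaled_le hξ₀
  -- Within `1 - c` of `ξ₀` the frequency keeps norm at least `c`, where homogeneity holds.
  set δ := min δ₁ (1 - c) with hδ
  have hδ0 : 0 < δ := lt_min hδ₁ (by linarith)
  refine ⟨M + r, 7 ^ r * (C₁ + C₀ / δ ^ r), by positivity, fun k hk x η => ?_⟩
  have hk0 : 0 < k := by linarith
  have hs0 : 0 < √k := by positivity
  -- `t` dominates the distance from `v`, the point with frequency divided by `k`, to `(x₀, ξ₀)`;
  -- the gain `k ^ (-r/2)` sits in `t ^ r`.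
  set t := (√k)⁻¹ * 7 * (1 + √k * ‖x - x₀‖) * (1 + ‖η‖) with ht
  have ht0 : 0 ≤ t := by positivity
  have hη1 : 1 ≤ 1 + ‖η‖ := by linarith [norm_nonneg η]
  set v : RSpace n × RSpace n := (x, ξ₀ + (2 * Real.pi * (√k)⁻¹) • η) with hvdef
  have hn2 : ‖(2 * Real.pi * (√k)⁻¹) • η‖ = 2 * Real.pi * (√k)⁻¹ * ‖η‖ := by
    rw [norm_smul, Real.norm_of_nonneg (by positivity)]
  have hvt : ‖v - (x₀, ξ₀)‖ ≤ t := by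
    have hpi := Real.pi_lt_d2
    have e : t = 7 * (√k)⁻¹ * (1 + ‖η‖) + 7 * ‖x - x₀‖ * (1 + ‖η‖) := by
      rw [ht]; field_simp
    have hx := norm_nonneg (x - x₀)
    rw [hvdef, Prod.mk_sub_mk, Prod.norm_def, max_le_iff]
    simp only [add_sub_cancel_left]
    have p1 : 0 ≤ 7 * (√k)⁻¹ * (1 + ‖η‖) := by positivity
    have p2 : 0 ≤ 7 * ‖x - x₀‖ * (1 + ‖η‖) := by positivity
    constructor
    · rw [e]; nlinarith [mul_nonneg hx (norm_nonneg η)]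
    · rw [e, hn2]
      have : 2 * Real.pi * (√k)⁻¹ * ‖η‖ ≤ 7 * (√k)⁻¹ * (1 + ‖η‖) := by gcongr <;> linarith
      linarith
  have hfin : ∀ D : ℝ, 0 ≤ D → D ≤ C₁ + C₀ / δ ^ r → D * k ^ μ * t ^ r * (1 + ‖η‖) ^ M ≤
      7 ^ r * (C₁ + C₀ / δ ^ r) * k ^ (μ - r / 2) * (1 + √k * ‖x - x₀‖) ^ r *
        (1 + ‖η‖) ^ (M + r) := by
    intro D _ hD
    have e : k ^ (μ - r / 2) = k ^ μ * ((√k)⁻¹) ^ r := by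
      rw [Real.rpow_sub hk0, inv_pow, div_eq_mul_inv, Real.sqrt_eq_rpow, ← Real.rpow_natCast,
        ← Real.rpow_mul hk0.le]
      ring_nf
    calc _ = D * (7 ^ r * (k ^ μ * ((√k)⁻¹) ^ r) * (1 + √k * ‖x - x₀‖) ^ r *
          (1 + ‖η‖) ^ (M + r)) := by
          rw [ht, mul_pow, mul_pow, mul_pow, pow_add]; ring
      _ ≤ (C₁ + C₀ / δ ^ r) * (7 ^ r * (k ^ μ * ((√k)⁻¹) ^ r) * (1 + √k * ‖x - x₀‖) ^ r *
          (1 + ‖η‖) ^ (M + r)) := by gcongr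
      _ = _ := by rw [e]; ring
  rcases le_or_gt ‖v - (x₀, ξ₀)‖ δ with hle | hgt
  · have hξ : rescaledFrequency ξ₀ k η = k • v.2 := by
      rw [rescaledFrequency, hvdef, smul_add, smul_smul]
      congr 2
      have : √k * √k = k := Real.mul_self_sqrt hk0.le
      field_simp
      linear_combination this
    have hcv : c ≤ ‖v.2‖ := by
      have h1 : ‖v.2 - ξ₀‖ ≤ 1 - c :=
        (norm_snd_le (v - (x₀, ξ₀))).trans (hle.trans (min_le_right _ _))
      have h2 := norm_sub_norm_le ξ₀ v.2
      rw [norm_sub_rev, hξ₀] at h2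
      linarith
    have hckv : c ≤ ‖k • v.2‖ := by
      rw [norm_smul, Real.norm_of_nonneg hk0.le]
      nlinarith [norm_nonneg v.2]
    rw [hξ, show x = v.1 from rfl, hhom v.1 v.2 k hk0 hcv hckv, norm_mul, Complex.norm_real,
      Real.norm_of_nonneg (by positivity)]
    refine le_trans ?_ (hfin C₁ hC₁ (by linarith [show 0 ≤ C₀ / δ ^ r by positivity]))
    calc _ ≤ k ^ μ * (C₁ * t ^ r) := by
          gcongr
          exact (hT v (hle.trans (min_le_left _ _))).trans (by gcongr)
      _ = C₁ * k ^ μ * t ^ r * 1 := by ring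
      _ ≤ _ := by gcongr; exact one_le_pow₀ hη1
  -- Far from `(x₀, ξ₀)` no vanishing is needed: `t / δ ≥ 1`, so the plain symbol bound may be
  -- multiplied by `(t / δ) ^ r`.
  · refine le_trans ?_ (hfin (C₀ / δ ^ r) (by positivity) (by linarith))
    have h1 : 1 ≤ (t / δ) ^ r := one_le_pow₀ ((one_le_div hδ0).2 (hgt.le.trans hvt))
    calc _ ≤ C₀ * k ^ μ * (1 + ‖η‖) ^ M := hS k hk x η
      _ ≤ C₀ * k ^ μ * (1 + ‖η‖) ^ M * (t / δ) ^ r := le_mul_of_one_le_right (by positivity) h1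
      _ = _ := by rw [div_pow]; ring

/-- Under the vanishing hypotheses the full symbol gains `k ^ (-ℓ / 2)` at distance `k ^ (-1 / 2)`
from the ray through `(x₀, ξ₀)`. -/
lemma HasPolyhomogeneousExpansion.norm_rescaled_le {x₀ ξ₀ : RSpace n} (hξ₀ : ‖ξ₀‖ = 1) {m : ℝ}
    {a : RSpace n × RSpace n → ℂ} {aj : ℕ → RSpace n × RSpace n → ℂ}
    (ha : HasPolyhomogeneousExpansion m a aj) {ℓ : ℕ}
    (hv : ∀ j : ℕ, 2 * j ≤ ℓ → VanishesToOrder (ℓ - 2 * j) (aj j) (x₀, ξ₀)) :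
    ∃ (M : ℕ) (C : ℝ), 0 ≤ C ∧ ∀ k : ℝ, 1 ≤ k → ∀ x η : RSpace n,
      ‖a (x, rescaledFrequency ξ₀ k η)‖ ≤
        C * k ^ (m - ℓ / 2) * (1 + √k * ‖x - x₀‖) ^ ℓ * (1 + ‖η‖) ^ M := by
  have hterm : ∀ j : ℕ, ∃ (M : ℕ) (C : ℝ), 0 ≤ C ∧ (2 * j ≤ ℓ → ∀ k : ℝ, 1 ≤ k →
      ∀ x η : RSpace n, ‖aj j (x, rescaledFrequency ξ₀ k η)‖ ≤
        C * k ^ (m - ℓ / 2) * (1 + √k * ‖x - x₀‖) ^ ℓ * (1 + ‖η‖) ^ M) := by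
    intro j
    by_cases hj : 2 * j ≤ ℓ
    · obtain ⟨c, _, hc, hhom⟩ := ha.term_homogeneous j
      obtain ⟨M, C, hC, h⟩ :=
        (ha.term_symbol j).norm_rescaled_le_of_vanishesToOrder hξ₀ hc hhom (hv j hj)
      refine ⟨M, C, hC, fun _ k hk x η => (h k hk x η).trans ?_⟩
      -- Lower order in the expansion compensates exactly for weaker vanishing.
      have e : m - j - ((ℓ - 2 * j : ℕ) : ℝ) / 2 = m - ℓ / 2 := by
        push_cast [Nat.cast_sub hj]; ring
      rw [e]
      have : 1 ≤ 1 + √k * ‖x - x₀‖ := le_add_of_nonneg_right (by positivity)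
      gcongr
      omega
    · exact ⟨0, 0, le_rfl, fun h => absurd h hj⟩
  choose M C hC h using hterm
  -- This is `ℓ / 2` rounded up: the remainder has order at most `m - ℓ / 2`, and every `j < N`
  -- satisfies `2 * j ≤ ℓ`.
  set N := (ℓ + 1) / 2 with hN
  obtain ⟨M', C', hC', h'⟩ := (ha.remainder N).norm_rescaled_le hξ₀
  refine ⟨M' + ∑ j ∈ Finset.range N, M j, C' + ∑ j ∈ Finset.range N, C j,
    add_nonneg hC' (Finset.sum_nonneg fun j _ => hC j), fun k hk x η => ?_⟩
  have hk0 : 0 < k := by linarith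
  have hη1 : 1 ≤ 1 + ‖η‖ := by linarith [norm_nonneg η]
  have hx1 : 1 ≤ 1 + √k * ‖x - x₀‖ := le_add_of_nonneg_right (by positivity)
  set ξ := rescaledFrequency ξ₀ k η
  set B := k ^ (m - ℓ / 2) * (1 + √k * ‖x - x₀‖) ^ ℓ *
    (1 + ‖η‖) ^ (M' + ∑ j ∈ Finset.range N, M j) with hB
  have h1 : ‖a (x, ξ) - ∑ j ∈ Finset.range N, aj j (x, ξ)‖ ≤ C' * B := by
    refine (h' k hk x η).trans ?_
    rw [hB, mul_assoc]
    gcongr ?_ * ?_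
    have h2 : k ^ (m - N) ≤ k ^ (m - ℓ / 2) := by
      refine Real.rpow_le_rpow_of_exponent_le hk ?_
      have : (ℓ : ℝ) ≤ 2 * N := by exact_mod_cast (by omega : ℓ ≤ 2 * N)
      linarith
    calc _ ≤ k ^ (m - ℓ / 2) * (1 + ‖η‖) ^ (M' + ∑ j ∈ Finset.range N, M j) := by
          gcongr
          omega
      _ ≤ _ := by
          gcongr
          exact le_mul_of_one_le_right (by positivity) (one_le_pow₀ hx1)
  have h2 : ∀ j ∈ Finset.range N, ‖aj j (x, ξ)‖ ≤ C j * B := by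
    intro j hj
    have hjN := Finset.mem_range.1 hj
    refine (h j (by omega) k hk x η).trans ?_
    rw [hB, mul_assoc, mul_assoc, ← mul_assoc (k ^ _)]
    have hCj := hC j
    gcongr
    exact (Finset.single_le_sum (fun _ _ => Nat.zero_le _) hj).trans (Nat.le_add_left _ _)
  calc ‖a (x, ξ)‖ = ‖(a (x, ξ) - ∑ j ∈ Finset.range N, aj j (x, ξ)) +
        ∑ j ∈ Finset.range N, aj j (x, ξ)‖ := by rw [sub_add_cancel]
    _ ≤ C' * B + ∑ j ∈ Finset.range N, C j * B :=
        (norm_add_le _ _).trans (add_le_add h1 (norm_sum_le_of_le _ h2))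
    _ = _ := by rw [hB, ← Finset.sum_mul]; ring

end Symbols

/-! ### Rescaling the quantization, and interpolation of the two bounds -/

section Quantization

variable {n : ℕ}

lemma matrixForm_smul (A : Matrix (Fin n) (Fin n) ℂ) (s : ℝ) (v : RSpace n) :
    matrixForm A (s • v) = (s : ℂ) ^ 2 * matrixForm A v := by
  simp only [matrixForm, Finset.mul_sum, PiLp.smul_apply, smul_eq_mul, Complex.ofReal_mul]
  exact Finset.sum_congr rfl fun _ _ => Finset.sum_congr rfl fun _ _ => by ring

/-- Change of variables by an affine dilation. -/
lemma integral_eq_smul_integral_affine (f : RSpace n → ℂ) (c : RSpace n) {s : ℝ} (hs : 0 < s) :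
    ∫ v, f v = ((s ^ n : ℝ) : ℂ) * ∫ v, f (c + s • v) := by
  rw [Measure.integral_comp_smul volume (fun v => f (c + v)) s, integral_add_left_eq_self f c,
    finrank_euclideanSpace_fin, abs_of_pos (by positivity), Complex.real_smul, ← mul_assoc,
    ← Complex.ofReal_mul, mul_inv_cancel₀ (by positivity), Complex.ofReal_one, one_mul]

/-- The action of `Op a` on a coherent state, in the rescaled variables. -/
lemma Op_coherentState (a : RSpace n × RSpace n → ℂ) (x₀ ξ₀ : RSpace n)
    (A : Matrix (Fin n) (Fin n) ℂ) (b : RSpace n → ℂ) {k : ℝ} (hk : 0 < k) (x : RSpace n) :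
    Op a (coherentState x₀ ξ₀ A b k) x =
      ((k ^ ((n : ℝ) / 4) : ℝ) : ℂ) * exp (I * k * ((inner ℝ (x - x₀) ξ₀ : ℝ) : ℂ)) *
        𝓕⁻ (fun η => a (x, rescaledFrequency ξ₀ k η) * 𝓕 (rescaledState x₀ A b k) η)
          (√k • (x - x₀)) := by
  have hs : 0 < √k := Real.sqrt_pos.2 hk
  set κ : ℂ := ((k ^ ((n : ℝ) / 4) : ℝ) : ℂ) * exp (I * k * ((inner ℝ (x - x₀) ξ₀ : ℝ) : ℂ))
  have hinner : ∀ η : RSpace n, (∫ y, exp (I * ((inner ℝ (x - y) (k • ξ₀ + (2 * Real.pi * √k) • η)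
        : ℝ) : ℂ)) * a (x, k • ξ₀ + (2 * Real.pi * √k) • η) * coherentState x₀ ξ₀ A b k y) =
      (((√k)⁻¹ ^ n : ℝ) : ℂ) * (κ * (exp (((2 * Real.pi * inner ℝ η (√k • (x - x₀)) : ℝ) : ℂ) * I) *
        (a (x, k • ξ₀ + (2 * Real.pi * √k) • η) * 𝓕 (rescaledState x₀ A b k) η))) := by
    intro η
    rw [integral_eq_smul_integral_affine _ x₀ (inv_pos.2 hs), Real.fourier_eq']
    congr 1
    rw [← integral_const_mul, ← integral_const_mul, ← integral_const_mul]
    congr 1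
    ext w
    -- The oscillation of the state at frequency `k ξ₀` cancels against the kernel; what remains is
    -- a phase in `x` and the two Fourier kernels.
    have e1 : exp (I * ((inner ℝ (x - (x₀ + (√k)⁻¹ • w)) (k • ξ₀ + (2 * Real.pi * √k) • η) : ℝ)
          : ℂ)) * exp (I * k * ((inner ℝ ((√k)⁻¹ • w) ξ₀ : ℝ) : ℂ)) =
        exp (I * k * ((inner ℝ (x - x₀) ξ₀ : ℝ) : ℂ)) *
          exp (((2 * Real.pi * inner ℝ η (√k • (x - x₀)) : ℝ) : ℂ) * I) *
          exp (((-2 * Real.pi * inner ℝ w η : ℝ) : ℂ) * I) := by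
      rw [← Complex.exp_add, ← Complex.exp_add, ← Complex.exp_add]
      congr 1
      have e : x - (x₀ + (√k)⁻¹ • w) = (x - x₀) - (√k)⁻¹ • w := by abel
      rw [e]
      simp only [inner_sub_left, inner_add_right, inner_smul_left, inner_smul_right,
        real_inner_comm (x - x₀) η, RCLike.conj_to_real]
      have hsc : (√k : ℂ) ≠ 0 := by exact_mod_cast hs.ne'
      push_cast
      field_simp
      ring
    have e2 : exp (I * k / 2 * matrixForm A ((√k)⁻¹ • w)) = exp (I / 2 * matrixForm A w) := by
      rw [matrixForm_smul]
      congr 1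
      have : (k : ℂ) * (((√k)⁻¹ : ℝ) : ℂ) ^ 2 = 1 := by
        rw [← Complex.ofReal_pow, ← Complex.ofReal_mul, inv_pow, Real.sq_sqrt hk.le,
          mul_inv_cancel₀ hk.ne', Complex.ofReal_one]
      linear_combination (I / 2 * matrixForm A w) * this
    simp only [coherentState, rescaledState, add_sub_cancel_left, e2, smul_eq_mul]
    linear_combination (a (x, k • ξ₀ + (2 * Real.pi * √k) • η) * ((k ^ ((n : ℝ) / 4) : ℝ) : ℂ) *
      exp (I / 2 * matrixForm A w) * b (x₀ + (√k)⁻¹ • w)) * e1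
  rw [Op, integral_eq_smul_integral_affine _ (k • ξ₀) (show 0 < 2 * Real.pi * √k by positivity)]
  simp only [hinner]
  rw [integral_const_mul, integral_const_mul, Real.fourierInv_eq']
  simp only [rescaledFrequency, smul_eq_mul]
  rw [← mul_assoc, ← mul_assoc, ← Complex.ofReal_inv, ← Complex.ofReal_mul,
    ← Complex.ofReal_mul]
  -- The Jacobians of the substitutions in `ξ` and `y` cancel the prefactor of `Op`.
  have : ((2 * Real.pi) ^ n)⁻¹ * (2 * Real.pi * √k) ^ n * (√k)⁻¹ ^ n = 1 := by
    rw [mul_pow _ (√k), inv_pow]; field_simp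
  rw [this, Complex.ofReal_one, one_mul]

lemma stronglyMeasurable_Op {a : RSpace n × RSpace n → ℂ} (ha : Continuous a) {u : RSpace n → ℂ}
    (hu : Continuous u) : StronglyMeasurable (Op a u) := by
  unfold Op
  refine StronglyMeasurable.const_mul ?_ _
  have h : StronglyMeasurable (fun p : (RSpace n × RSpace n) × RSpace n =>
      exp (I * ((inner ℝ (p.1.1 - p.2) p.1.2 : ℝ) : ℂ)) * a (p.1.1, p.1.2) * u p.2) := by
    refine Continuous.stronglyMeasurable ?_
    fun_prop
  exact h.integral_prod_right.integral_prod_right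

lemma continuous_coherentState (x₀ ξ₀ : RSpace n) (A : Matrix (Fin n) (Fin n) ℂ)
    {b : RSpace n → ℂ} (hb : Continuous b) (k : ℝ) : Continuous (coherentState x₀ ξ₀ A b k) := by
  unfold coherentState matrixForm
  fun_prop

lemma eLpNorm_two_le_of_sq_le {E : Type*} [MeasurableSpace E] {μ : Measure E} {f : E → ℂ}
    {g : E → ℝ} (hg : Integrable g μ) (h : ∀ x, ‖f x‖ ^ 2 ≤ g x) {R : ℝ} (hR : 0 ≤ R)
    (hgR : ∫ x, g x ∂μ ≤ R ^ 2) : eLpNorm f 2 μ ≤ ENNReal.ofReal R := by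
  have h1 : ∫⁻ x, ‖f x‖ₑ ^ (2 : ℝ) ∂μ ≤ ENNReal.ofReal R ^ (2 : ℝ) := by
    calc _ ≤ ∫⁻ x, ENNReal.ofReal (g x) ∂μ := by
          refine lintegral_mono fun x => ?_
          rw [← ofReal_norm, ENNReal.ofReal_rpow_of_nonneg (norm_nonneg _) two_pos.le]
          exact ENNReal.ofReal_le_ofReal (by simpa using h x)
      _ = ENNReal.ofReal (∫ x, g x ∂μ) :=
          (ofReal_integral_eq_lintegral_ofReal hg
            (Filter.Eventually.of_forall fun x => (by positivity : 0 ≤ ‖f x‖ ^ 2).trans (h x))).symm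
      _ ≤ _ := by
          rw [ENNReal.ofReal_rpow_of_nonneg hR two_pos.le]
          exact ENNReal.ofReal_le_ofReal (by simpa using hgR)
  rw [eLpNorm_eq_lintegral_rpow_enorm_toReal two_ne_zero ENNReal.ofNat_ne_top]
  simp only [ENNReal.toReal_ofNat]
  calc _ ≤ (ENNReal.ofReal R ^ (2 : ℝ)) ^ (1 / (2 : ℝ)) := by gcongr
    _ = _ := by rw [← ENNReal.rpow_mul]; norm_num

/-- Interpolation between a growing bound with a good constant and a decaying bound with a bad
constant. -/
lemma exists_pow_mul_le_rpow {C₁ μ m ε : ℝ} (hC₁ : 0 ≤ C₁) (hε : 0 < ε)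
    (ℓ P : ℕ) (hP : 0 < P) : ∃ N : ℕ, ∀ C₂ : ℝ, 0 ≤ C₂ → ∀ k t X : ℝ, 1 ≤ k → 1 ≤ t →
      X ≤ C₁ * k ^ μ * t ^ ℓ → t ^ N * X ≤ C₂ * k ^ m → t ^ P * X ≤ (C₁ + C₂) * k ^ (μ + ε) := by
  have hQ : (0 : ℝ) < (ℓ + P : ℕ) := by exact_mod_cast (by omega : 0 < ℓ + P)
  -- Chosen so that `t ≤ k ^ δ` gives `t ^ (ℓ + P) ≤ k ^ ε`; then `R` is large enough that `t ^ R >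
  -- k ^ (δ R)` makes up for the loss `k ^ (m - μ)`. The exponent `N = P + R` is fixed before `C₂`,
  -- which will depend on it.
  set δ := ε / (ℓ + P : ℕ) with hδ
  have hδ0 : 0 < δ := div_pos hε hQ
  set R := ⌈(m - μ) / δ⌉₊
  refine ⟨P + R, fun C₂ hC₂ k t X hk ht h₁ h₂ => ?_⟩
  have hk0 : 0 < k := by linarith
  have hR : m ≤ μ + ε + δ * R := by
    have h := Nat.le_ceil ((m - μ) / δ)
    rw [div_le_iff₀ hδ0] at h
    linarith
  have hkp : 0 ≤ k ^ (μ + ε) := by positivity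
  rw [add_mul]
  rcases le_or_gt t (k ^ δ) with hle | hgt
  · calc t ^ P * X ≤ t ^ P * (C₁ * k ^ μ * t ^ ℓ) := by gcongr
      _ = C₁ * k ^ μ * t ^ (ℓ + P) := by rw [pow_add]; ring
      _ ≤ C₁ * k ^ μ * (k ^ δ) ^ (ℓ + P) := by gcongr
      _ = C₁ * k ^ (μ + ε) := by
          rw [← Real.rpow_natCast, ← Real.rpow_mul hk0.le, hδ, div_mul_cancel₀ _ hQ.ne', mul_assoc,
            Real.rpow_add hk0]
      _ ≤ _ := le_add_of_nonneg_right (by positivity)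
  · refine le_trans ?_ (le_add_of_nonneg_left (by positivity))
    have hkR : 0 < k ^ (δ * R) := by positivity
    refine le_of_mul_le_mul_left (a := k ^ (δ * R)) ?_ hkR
    have h3 : k ^ m ≤ k ^ (μ + ε) * k ^ (δ * R) := by
      rw [← Real.rpow_add hk0]
      exact Real.rpow_le_rpow_of_exponent_le hk hR
    rcases le_total X 0 with hX | hX
    · exact (mul_nonpos_of_nonneg_of_nonpos hkR.le
        (mul_nonpos_of_nonneg_of_nonpos (by positivity) hX)).trans (by positivity)
    calc _ ≤ t ^ R * (t ^ P * X) := by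
          rw [Real.rpow_mul hk0.le, Real.rpow_natCast]
          gcongr
      _ = t ^ (P + R) * X := by rw [pow_add]; ring
      _ ≤ C₂ * (k ^ (μ + ε) * k ^ (δ * R)) := h₂.trans (by gcongr)
      _ = _ := by ring

end Quantization

/-! ### The pointwise estimate and the `L²` bound -/

/-- Pointwise decay of `Op a` of a coherent state away from `x₀`. -/
lemma exists_norm_Op_coherentState_le {n : ℕ} {x₀ ξ₀ : RSpace n} (hξ₀ : ‖ξ₀‖ = 1)
    {b : RSpace n → ℂ} (hb : ContDiff ℝ ∞ b) (hb_supp : HasCompactSupport b)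
    {A : Matrix (Fin n) (Fin n) ℂ} (hA : HasPosDefIm A)
    {m : ℝ} {a : RSpace n × RSpace n → ℂ} {aj : ℕ → RSpace n × RSpace n → ℂ}
    (ha : HasPolyhomogeneousExpansion m a aj) {ℓ : ℕ}
    (hv : ∀ j : ℕ, 2 * j ≤ ℓ → VanishesToOrder (ℓ - 2 * j) (aj j) (x₀, ξ₀))
    {ε : ℝ} (hε : 0 < ε) (P : ℕ) (hP : 0 < P) :
    ∃ C : ℝ, 0 ≤ C ∧ ∀ k : ℝ, 1 ≤ k → ∀ x : RSpace n,
      (1 + ‖√k • (x - x₀)‖) ^ P * ‖Op a (coherentState x₀ ξ₀ A b k) x‖ ≤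
        k ^ ((n : ℝ) / 4) * (C * k ^ (m - ℓ / 2 + ε)) := by
  have hsym : IsSymbol m a := by simpa using ha.remainder 0
  have hG := (uniformlySchwartz_rescaledState x₀ hA hb hb_supp).fourier
  -- The position `x` enters both the symbol and the evaluation point `z`. Indexing the family by
  -- `(x, k)` gives decay in an independent variable, specialized to `z` afterwards.
  have hF := (hsym.uniformlyTemperate hξ₀).mul
    (hG.reindex fun i : RSpace n × Set.Ici (1 : ℝ) => i.2)
  obtain ⟨M, C₀, hC₀, hsmall⟩ := ha.norm_rescaled_le hξ₀ hv
  obtain ⟨C', hC', hgood⟩ := hG.norm_fourierInv_mul_le M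
  obtain ⟨N, hN⟩ := exists_pow_mul_le_rpow (μ := m - ℓ / 2) (m := m) (mul_nonneg hC' hC₀) hε ℓ P hP
  obtain ⟨C₂, hbad⟩ := hF.norm_fourierInv_le N
  refine ⟨C' * C₀ + |C₂|, by positivity, fun k hk x => ?_⟩
  have hk0 : 0 < k := by linarith
  rw [Op_coherentState a x₀ ξ₀ A b hk0, norm_mul, norm_mul, Complex.norm_real,
    Real.norm_of_nonneg (by positivity)]
  have h1 : ‖exp (I * k * ((inner ℝ (x - x₀) ξ₀ : ℝ) : ℂ))‖ = 1 := by
    rw [show I * k * ((inner ℝ (x - x₀) ξ₀ : ℝ) : ℂ) = ((k * inner ℝ (x - x₀) ξ₀ : ℝ) : ℂ) * I by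
      push_cast; ring, Complex.norm_exp_ofReal_mul_I]
  rw [h1, mul_one, mul_left_comm]
  refine mul_le_mul_of_nonneg_left ?_ (by positivity)
  set z := √k • (x - x₀) with hz
  have hzn : ‖z‖ = √k * ‖x - x₀‖ := by rw [hz, norm_smul, Real.norm_of_nonneg (by positivity)]
  have hcont : Continuous fun η => a (x, rescaledFrequency ξ₀ k η) := by
    have := hsym.smooth.continuous
    unfold rescaledFrequency
    fun_prop
  refine hN |C₂| (abs_nonneg _) k (1 + ‖z‖) _ hk (by linarith [norm_nonneg z]) ?_ ?_
  · refine (hgood ⟨k, hk⟩ (fun η => a (x, rescaledFrequency ξ₀ k η))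
      (C₀ * k ^ (m - ℓ / 2) * (1 + ‖z‖) ^ ℓ) hcont (by positivity) (fun η => ?_) z).trans_eq
        (by ring)
    rw [hzn]
    exact hsmall k hk x η
  · have h2 := (hbad (x, ⟨k, hk⟩) z).trans (le_abs_self C₂)
    have h3 : 𝓕⁻ (fun η => ((k ^ (-m) : ℝ) : ℂ) * a (x, rescaledFrequency ξ₀ k η) *
        𝓕 (rescaledState x₀ A b k) η) z = ((k ^ (-m) : ℝ) : ℂ) *
        𝓕⁻ (fun η => a (x, rescaledFrequency ξ₀ k η) * 𝓕 (rescaledState x₀ A b k) η) z := by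
      simp only [Real.fourierInv_eq', smul_eq_mul, ← integral_const_mul]
      congr 1
      ext η
      ring
    simp only at h2
    rw [h3, norm_mul, Complex.norm_real, Real.norm_of_nonneg (by positivity), mul_left_comm,
      Real.rpow_neg hk0.le, inv_mul_le_iff₀ (by positivity)] at h2
    rwa [mul_comm |C₂|]

theorem mainTheorem4 (n : ℕ) (x₀ ξ₀ : RSpace n) (hξ₀ : ‖ξ₀‖ = 1)
    (b : RSpace n → ℂ) (hb : ContDiff ℝ ∞ b) (hb_supp : HasCompactSupport b)
    (A : Matrix (Fin n) (Fin n) ℂ) (hA : HasPosDefIm A)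
    (m : ℝ) (a : RSpace n × RSpace n → ℂ) (aj : ℕ → RSpace n × RSpace n → ℂ)
    (ha : HasPolyhomogeneousExpansion m a aj)
    (ha_supp : ∃ K : Set (RSpace n), IsCompact K ∧ ∀ x ∉ K, ∀ ξ, a (x, ξ) = 0)
    (ℓ : ℕ) (hvanish : ∀ j : ℕ, 2 * j ≤ ℓ → VanishesToOrder (ℓ - 2 * j) (aj j) (x₀, ξ₀)) :
    ∀ ε : ℝ, 0 < ε → ∃ C : ℝ, 0 < C ∧ ∀ k : ℝ, 1 ≤ k →
      MemLp (Op a (coherentState x₀ ξ₀ A b k)) 2 volume ∧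
      eLpNorm (Op a (coherentState x₀ ξ₀ A b k)) 2 volume
        ≤ ENNReal.ofReal (C * k ^ (m - (ℓ : ℝ) / 2 + ε)) := by
  intro ε hε
  -- The power `n + 1` makes the weight integrable; being at most 1, it also dominates its square.
  obtain ⟨C, hC, hpt⟩ :=
    exists_norm_Op_coherentState_le hξ₀ hb hb_supp hA ha hvanish hε (n + 1) n.succ_pos
  have hint := integrable_one_add_norm_pow_inv (E := RSpace n)
  simp only [finrank_euclideanSpace_fin] at hint
  obtain ⟨J, hJ⟩ : ∃ J : ℝ, J = ∫ v : RSpace n, ((1 + ‖v‖) ^ (n + 1))⁻¹ := ⟨_, rfl⟩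
  have hJ0 : 0 ≤ J := hJ ▸ integral_nonneg fun v => by positivity
  -- The `+ 1` only makes the constant positive.
  refine ⟨C * √J + 1, by positivity, fun k hk => ?_⟩
  have hk0 : 0 < k := by linarith
  have hs : 0 < √k := Real.sqrt_pos.2 hk0
  set e := m - (ℓ : ℝ) / 2 + ε
  set B := k ^ ((n : ℝ) / 4) * (C * k ^ e) with hB
  have hB0 : 0 ≤ B := by positivity
  set g : RSpace n → ℝ := fun x => B ^ 2 * ((1 + ‖√k • (x - x₀)‖) ^ (n + 1))⁻¹ with hg
  have hgi : Integrable g :=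
    (((hint.comp_smul hs.ne').comp_sub_right x₀).const_mul (B ^ 2))
  have hgJ : ∫ x, g x = (C * √J * k ^ e) ^ 2 := by
    have h1 : ∫ x : RSpace n, ((1 + ‖√k • (x - x₀)‖) ^ (n + 1))⁻¹ = (√k ^ n)⁻¹ * J := by
      rw [integral_sub_right_eq_self (fun x : RSpace n => ((1 + ‖√k • x‖) ^ (n + 1))⁻¹) x₀,
        Measure.integral_comp_smul volume (fun v : RSpace n => ((1 + ‖v‖) ^ (n + 1))⁻¹) √k,
        finrank_euclideanSpace_fin, abs_of_pos (by positivity), smul_eq_mul, hJ]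
    have h2 : (k ^ ((n : ℝ) / 4)) ^ 2 = √k ^ n := by
      rw [Real.sqrt_eq_rpow, ← Real.rpow_natCast, ← Real.rpow_natCast, ← Real.rpow_mul hk0.le,
        ← Real.rpow_mul hk0.le]
      congr 1
      push_cast
      ring
    rw [hg, integral_const_mul, h1, hB, mul_pow, h2, mul_pow, mul_pow, mul_pow, Real.sq_sqrt hJ0]
    field_simp
  have hle : ∀ x, ‖Op a (coherentState x₀ ξ₀ A b k) x‖ ^ 2 ≤ g x := by
    intro x
    have h1 : 1 ≤ (1 + ‖√k • (x - x₀)‖) ^ (n + 1) :=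
      one_le_pow₀ (le_add_of_nonneg_right (norm_nonneg _))
    have h2 : ‖Op a (coherentState x₀ ξ₀ A b k) x‖ ≤ B * ((1 + ‖√k • (x - x₀)‖) ^ (n + 1))⁻¹ := by
      rw [← div_eq_mul_inv, le_div_iff₀ (by positivity), mul_comm]
      exact hpt k hk x
    calc _ ≤ (B * ((1 + ‖√k • (x - x₀)‖) ^ (n + 1))⁻¹) ^ 2 := by gcongr
      _ = B ^ 2 * (((1 + ‖√k • (x - x₀)‖) ^ (n + 1))⁻¹) ^ 2 := mul_pow _ _ _
      _ ≤ _ := mul_le_mul_of_nonneg_left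
          (pow_le_of_le_one (by positivity) (inv_le_one_of_one_le₀ h1) two_ne_zero) (sq_nonneg B)
  have hnorm : eLpNorm (Op a (coherentState x₀ ξ₀ A b k)) 2 volume ≤
      ENNReal.ofReal ((C * √J + 1) * k ^ e) := by
    refine (eLpNorm_two_le_of_sq_le hgi hle (R := C * √J * k ^ e) (by positivity) hgJ.le).trans ?_
    gcongr
    linarith
  have hsym : IsSymbol m a := by simpa using ha.remainder 0
  exact ⟨⟨(stronglyMeasurable_Op hsym.smooth.continuous
    (continuous_coherentState x₀ ξ₀ A hb.continuous k)).aestronglyMeasurable,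
    hnorm.trans_lt ENNReal.ofReal_lt_top⟩, hnorm⟩
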